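/- Let $n, D \ge 0$ be integers and $\beta \in \mathbb{R}^D$. Let $x$ be a standard normal random vector in $\mathbb{R}^D$, let $y = x^{\mathsf T}\beta$, and let $(x^{(1)},y^{(1)}),\dots,(x^{(n)},y^{(n)})$ be i.i.d. copies of $(x,y)$, independent of $(x,y)$. For $A \subseteq \{1,\dots,D\}$ write $A^c$ for its complement, $v_A$ for the subvector of $v \in \mathbb{R}^D$ with entries in $A$, and $X_A$ for the $n \times |A|$ matrix with rows $x^{(1)}_A,\dots,x^{(n)}_A$; let $\mathbf{y} = (y^{(1)},\dots,y^{(n)})$, and let $\|\cdot\|$ be the Euclidean norm. Fix $p \in \{0,\dots,D\}$ and $T \subseteq \{1,\dots,D\}$ with $|T| = p$, and define $\hat\beta \in \mathbb{R}^D$ by $\hat\beta_T = X_T^\dagger \mathbf{y}$ and $\hat\beta_{T^c} = 0$, where $\dagger$ denotes the Moore--Penrose pseudoinverse. Then the risk $\mathbb{E}[(y - x^{\mathsf T}\hat\beta)^2] \in [0,\infty]$ (expectation over both the sample and $(x,y)$) equals $$ \begin{cases} \|\beta_{T^c}\|^2 \left(1 + \frac{p}{n-p-1}\right) & \text{if }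 p \le n-2;\\ +\infty & \text{if } n-1 \le p \le n+1,\ n \ge 1,\ p \ge 1 \text{ and } \beta_{T^c} \ne 0;\\ \|\beta_T\|^2 \left(1 - \frac{n}{p}\right) + \|\beta_{T^c}\|^2 \left(1 + \frac{n}{p-n-1}\right) & \text{if } p \ge n+2;\\ \|\beta_T\|^2 \max\left\{1 - \frac{n}{p},\, 0\right\} & \text{if } \beta_{T^c} = 0, \end{cases} $$ where the last expression is read as $0$ when $p = 0$ (then $\beta_T$ is the empty vector). -/

import Mathlib

open MeasureTheory ProbabilityTheory
open scoped Matrix ENNReal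

namespace LeastNorm

/-- The four Penrose conditions: `B` is the Moore-Penrose pseudoinverse of the real matrix `A`. -/
structure IsMoorePenrose {m n : Type*} [Fintype m] [Fintype n]
    (A : Matrix m n ℝ) (B : Matrix n m ℝ) : Prop where
  mul_mul_self : A * B * A = A
  mul_self_mul : B * A * B = B
  symm_left : (A * B)ᵀ = A * B
  symm_right : (B * A)ᵀ = B * A

/-- The Moore-Penrose pseudoinverse is unique. -/
theorem IsMoorePenrose.unique {m n : Type*} [Fintype m] [Fintype n]
    {A : Matrix m n ℝ} {B C : Matrix n m ℝ}
    (hB : IsMoorePenrose A B) (hC : IsMoorePenrose A C) : B = C := by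
  have h1 : A * B = A * C := by
    calc A * B = (A * C * A) * B := by rw [hC.mul_mul_self]
      _ = (A * C) * (A * B) := by simp only [Matrix.mul_assoc]
      _ = (A * C)ᵀ * (A * B)ᵀ := by rw [hC.symm_left, hB.symm_left]
      _ = ((A * B) * (A * C))ᵀ := by rw [Matrix.transpose_mul (A * B) (A * C)]
      _ = ((A * B * A) * C)ᵀ := by simp only [Matrix.mul_assoc]
      _ = A * C := by rw [hB.mul_mul_self, hC.symm_left]
  have h2 : B * A = C * A := by
    calc B * A = B * (A * C * A) := by rw [hC.mul_mul_self]
      _ = (B * A) * (C * A) := by simp only [Matrix.mul_assoc]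
      _ = (B * A)ᵀ * (C * A)ᵀ := by rw [hC.symm_right, hB.symm_right]
      _ = ((C * A) * (B * A))ᵀ := by rw [Matrix.transpose_mul (C * A) (B * A)]
      _ = (C * (A * B * A))ᵀ := by simp only [Matrix.mul_assoc]
      _ = C * A := by rw [hB.mul_mul_self, hC.symm_right]
  calc B = B * (A * B) := by rw [← Matrix.mul_assoc, hB.mul_self_mul]
    _ = C * A * C := by rw [h1, ← Matrix.mul_assoc, h2]
    _ = C := hC.mul_self_mul

/-- The Moore-Penrose pseudoinverse exists. -/
theorem exists_isMoorePenrose {m n : Type*} [Fintype m] [Fintype n]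
    (A : Matrix m n ℝ) : ∃ B : Matrix n m ℝ, IsMoorePenrose A B := by
  classical
  have hG : (Aᵀ * A).IsHermitian := by
    simpa using Matrix.isHermitian_conjTranspose_mul_self A
  obtain ⟨H, h1, h2, h3, h4⟩ : ∃ H : Matrix n n ℝ, Hᵀ = H ∧ (Aᵀ * A) * H * (Aᵀ * A) = Aᵀ * A ∧
      H * (Aᵀ * A) * H = H ∧ H * (Aᵀ * A) = (Aᵀ * A) * H := by
    generalize Aᵀ * A = G at hG
    have key := hG.spectral_theorem
    rw [Unitary.conjStarAlgAut_apply] at key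
    set U : Matrix n n ℝ := (hG.eigenvectorUnitary : Matrix n n ℝ) with hU
    set d := hG.eigenvalues
    have hUU : Uᵀ * U = 1 := by
      have := Unitary.coe_star_mul_self hG.eigenvectorUnitary
      simpa [Matrix.star_eq_conjTranspose] using this
    have key' : G = U * Matrix.diagonal d * Uᵀ := by
      simpa [Matrix.star_eq_conjTranspose, Function.comp_def] using key
    have mid : ∀ X Y : Matrix n n ℝ, (U * X * Uᵀ) * (U * Y * Uᵀ) = U * (X * Y) * Uᵀ := by
      intro X Y
      calc (U * X * Uᵀ) * (U * Y * Uᵀ) = U * X * (Uᵀ * U) * Y * Uᵀ := by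
            simp only [Matrix.mul_assoc]
        _ = U * (X * Y) * Uᵀ := by rw [hUU]; simp only [Matrix.mul_assoc, Matrix.one_mul]
    refine ⟨U * Matrix.diagonal (fun i => (d i)⁻¹) * Uᵀ, ?_, ?_, ?_, ?_⟩
    · simp [Matrix.transpose_mul, Matrix.mul_assoc]
    · rw [key', mid, mid]
      simp
    · rw [key', mid, mid]
      have hd : ∀ i, (d i)⁻¹ * d i * (d i)⁻¹ = (d i)⁻¹ := fun i => by
        by_cases h : d i = 0 <;> simp [h]
      simp only [Matrix.diagonal_mul_diagonal, hd]
    · rw [key', mid, mid]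
      simp [mul_comm]
  have hA : A * (H * (Aᵀ * A)) = A := by
    have hz : (A * (H * (Aᵀ * A)) - A)ᴴ * (A * (H * (Aᵀ * A)) - A) = 0 := by
      have e : (A * (H * (Aᵀ * A)) - A)ᴴ * (A * (H * (Aᵀ * A)) - A)
          = ((Aᵀ * A) * H - 1) * ((Aᵀ * A) * H * (Aᵀ * A) - Aᵀ * A) := by
        simp only [Matrix.conjTranspose_eq_transpose_of_trivial, Matrix.transpose_sub,
          Matrix.transpose_mul, Matrix.transpose_transpose, h1, Matrix.sub_mul, Matrix.mul_sub,
          Matrix.mul_assoc, Matrix.one_mul]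
      rw [e, h2, sub_self, Matrix.mul_zero]
    exact sub_eq_zero.mp (Matrix.conjTranspose_mul_self_eq_zero.mp hz)
  refine ⟨H * Aᵀ, ⟨?_, ?_, ?_, ?_⟩⟩
  · rw [Matrix.mul_assoc, Matrix.mul_assoc, hA]
  · calc H * Aᵀ * A * (H * Aᵀ) = (H * (Aᵀ * A) * H) * Aᵀ := by simp only [Matrix.mul_assoc]
      _ = H * Aᵀ := by rw [h3]
  · simp [Matrix.transpose_mul, Matrix.mul_assoc, h1]
  · rw [Matrix.mul_assoc, h4]
    rw [← h4]
    simp only [Matrix.transpose_mul, Matrix.transpose_transpose, h1]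
    rw [h4]

/-- The Moore-Penrose pseudoinverse of a real matrix: the matrix satisfying the four Penrose
conditions. -/
noncomputable def pinv {m n : Type*} [Fintype m] [Fintype n] (A : Matrix m n ℝ) : Matrix n m ℝ :=
  Classical.choose (exists_isMoorePenrose A)

theorem pinv_spec {m n : Type*} [Fintype m] [Fintype n] (A : Matrix m n ℝ) :
    IsMoorePenrose A (pinv A) :=
  Classical.choose_spec (exists_isMoorePenrose A)

/-- The subvector `v_A = (v_j : j ∈ A)`. -/
def subvec {D : ℕ} (A : Finset (Fin D)) (v : EuclideanSpace ℝ (Fin D)) : EuclideanSpace ℝ A :=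
  WithLp.toLp 2 fun j => v j

/-- The `n × |A|` design matrix `X_A`, with rows `x⁽¹⁾_A, …, x⁽ⁿ⁾_A`. -/
def design {n D : ℕ} (A : Finset (Fin D)) (xs : Fin n → EuclideanSpace ℝ (Fin D)) :
    Matrix (Fin n) A ℝ :=
  Matrix.of fun i j => xs i j

/-- The fitted coefficients: the entries indexed by `T` are those of `X_T† y`, all others are zero. -/
noncomputable def betaHat {n D : ℕ} (T : Finset (Fin D))
    (xs : Fin n → EuclideanSpace ℝ (Fin D)) (ys : Fin n → ℝ) : EuclideanSpace ℝ (Fin D) :=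
  WithLp.toLp 2 fun j => if h : j ∈ T then (pinv (design T xs) *ᵥ ys) ⟨j, h⟩ else 0

/-- The mean squared prediction error `E[(y - xᵀ b)²] ∈ [0, ∞]` of a (random) coefficient
vector `b`. -/
noncomputable def risk {Ω : Type*} [MeasurableSpace Ω] (P : Measure Ω) {D : ℕ}
    (x : Ω → EuclideanSpace ℝ (Fin D)) (y : Ω → ℝ) (b : Ω → EuclideanSpace ℝ (Fin D)) : ℝ≥0∞ :=
  ∫⁻ ω, ENNReal.ofReal ((y ω - inner ℝ (x ω) (b ω)) ^ 2) ∂P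

end LeastNorm

/-!
The new pair `(x, y)` is independent of the sample and `x` is standard normal, so the risk is the
expected squared estimation error `E ‖β - β̂‖²` (`risk_betaHat_eq`). Write `A = X_T`, `u = β_T`,
and let `z` be the contribution of the columns outside `T` to the response, so that the fit is
`A† (A u + z)`. The coordinates outside `T` contribute `‖β_{Tᶜ}‖²`. On `T` the error vector is
`(1 - A† A) u - A† z`, and its two terms are orthogonal because `A† A` is an orthogonal projection
fixing the range of `A†` (`norm_sq_sub_betaHat`).

* `A† A` projects onto the row space of a Gaussian matrix, whose law is invariant under sign changes
  and permutations of the columns. Hence its expectation is a multiple of the identity, and the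
  multiple is read off from the trace, which almost surely is the rank
  (`lintegral_norm_sq_sub_rowProj_mulVec`).
* `z` is a Gaussian vector of covariance `‖β_{Tᶜ}‖² • 1` independent of `A`, so the second term
  contributes `‖β_{Tᶜ}‖²` times the expected squared Frobenius norm of `A†`
  (`lintegral_norm_sq_sub_betaHat`).

For the Frobenius norm of the pseudoinverse of an `n × p` matrix with `p ≤ n`, row `j` of `A†` is
`v / ‖v‖²`, where `v` is the component of column `j` orthogonal to the other columns
(`norm_sq_pinvRow_mul`). Given those columns, `v` is a standard Gaussian vector in dimension
`n - p + 1`, so the row contributes the inverse moment of a chi-squared variable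
(`lintegral_norm_sq_pinvRow`). With `d` degrees of freedom this moment is `1 / (d - 2)`, and it is
infinite for `d ≤ 2`, as follows from `1 / r = ∫ exp (-t r) dt` and the Gaussian integral
(`lintegral_inv_norm_sq_stdGaussian_eq`). Transposition gives the case `p ≥ n`. All expectations are
taken in `[0, ∞]`, so the finite and the infinite cases are treated together.
-/

namespace LeastNorm

/-! ### The Moore-Penrose pseudoinverse -/

section Pseudoinverse

variable {m n : Type*} [Fintype m] [Fintype n]

theorem pinv_eq_of_isMoorePenrose {A : Matrix m n ℝ} {B : Matrix n m ℝ} (h : IsMoorePenrose A B) :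
    pinv A = B :=
  (pinv_spec A).unique h

theorem pinv_transpose (A : Matrix m n ℝ) : pinv Aᵀ = (pinv A)ᵀ := by
  have h := pinv_spec A
  refine pinv_eq_of_isMoorePenrose ⟨?_, ?_, ?_, ?_⟩
  · rw [← Matrix.transpose_mul, ← Matrix.transpose_mul, ← Matrix.mul_assoc, h.mul_mul_self]
  · rw [← Matrix.transpose_mul, ← Matrix.transpose_mul, ← Matrix.mul_assoc, h.mul_self_mul]
  · rw [← Matrix.transpose_mul, Matrix.transpose_transpose, h.symm_right]
  · rw [← Matrix.transpose_mul, Matrix.transpose_transpose, h.symm_left]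

/-- The pseudoinverse is equivariant under an orthogonal change of the column coordinates. -/
theorem pinv_mul_of_orthogonal [DecidableEq n] (A : Matrix m n ℝ) {S : Matrix n n ℝ}
    (hS : S * Sᵀ = 1) : pinv (A * S) = Sᵀ * pinv A := by
  have h := pinv_spec A
  have hS' : Sᵀ * S = 1 := mul_eq_one_comm.mp hS
  have e : A * S * (Sᵀ * pinv A) = A * pinv A := by
    rw [Matrix.mul_assoc A, ← Matrix.mul_assoc S, hS, Matrix.one_mul]
  refine pinv_eq_of_isMoorePenrose ⟨?_, ?_, ?_, ?_⟩
  · rw [e, ← Matrix.mul_assoc, h.mul_mul_self]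
  · rw [Matrix.mul_assoc, e, Matrix.mul_assoc, ← Matrix.mul_assoc (pinv A), h.mul_self_mul]
  · rw [e, h.symm_left]
  · rw [show Sᵀ * pinv A * (A * S) = Sᵀ * (pinv A * A) * S by simp only [Matrix.mul_assoc]]
    simp only [Matrix.transpose_mul, Matrix.transpose_transpose]
    rw [← Matrix.transpose_mul, h.symm_right]
    simp only [Matrix.mul_assoc]

theorem pinv_mul_self_of_linearIndependent [DecidableEq n] {A : Matrix m n ℝ}
    (hA : LinearIndependent ℝ A.col) : pinv A * A = 1 := by
  have hinj := Matrix.mulVec_injective_iff.mpr hA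
  refine Matrix.ext_of_mulVec_single fun i => hinj ?_
  rw [Matrix.mulVec_mulVec, Matrix.mulVec_mulVec, ← Matrix.mul_assoc, (pinv_spec A).mul_mul_self,
    Matrix.mul_one]

/-- The graph of the pseudoinverse is the closed set cut out by the Penrose conditions, and the
first projection is injective on it, so Borel sets pull back to Borel sets by the
Lusin-Souslin theorem. -/
theorem measurable_pinv : Measurable fun W : m → n → ℝ => fun i j => pinv (Matrix.of W) i j := by
  classical
  intro s hs
  let G : Set ((m → n → ℝ) × (n → m → ℝ)) :=
    {q | IsMoorePenrose (Matrix.of q.1) (Matrix.of q.2)}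
  have hG : MeasurableSet G := by
    have e : G = {q | Matrix.of q.1 * Matrix.of q.2 * Matrix.of q.1 = Matrix.of q.1} ∩
        {q | Matrix.of q.2 * Matrix.of q.1 * Matrix.of q.2 = Matrix.of q.2} ∩
        {q | (Matrix.of q.1 * Matrix.of q.2)ᵀ = Matrix.of q.1 * Matrix.of q.2} ∩
        {q | (Matrix.of q.2 * Matrix.of q.1)ᵀ = Matrix.of q.2 * Matrix.of q.1} := by
      ext q
      exact ⟨fun h => ⟨⟨⟨h.1, h.2⟩, h.3⟩, h.4⟩, fun h => ⟨h.1.1.1, h.1.1.2, h.1.2, h.2⟩⟩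
    have c1 : Continuous fun q : (m → n → ℝ) × (n → m → ℝ) => (Matrix.of q.1 : Matrix m n ℝ) :=
      continuous_fst
    have c2 : Continuous fun q : (m → n → ℝ) × (n → m → ℝ) => (Matrix.of q.2 : Matrix n m ℝ) :=
      continuous_snd
    rw [e]
    refine (((IsClosed.inter ?_ ?_).inter ?_).inter ?_).measurableSet
    · exact isClosed_eq ((c1.matrix_mul c2).matrix_mul c1) c1
    · exact isClosed_eq ((c2.matrix_mul c1).matrix_mul c2) c2
    · exact isClosed_eq (c1.matrix_mul c2).matrix_transpose (c1.matrix_mul c2)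
    · exact isClosed_eq (c2.matrix_mul c1).matrix_transpose (c2.matrix_mul c1)
  have key : (fun W : m → n → ℝ => fun i j => pinv (Matrix.of W) i j) ⁻¹' s
      = Prod.fst '' (G ∩ Prod.snd ⁻¹' s) := by
    ext W
    constructor
    · intro hW
      exact ⟨(W, fun i j => pinv (Matrix.of W) i j), ⟨pinv_spec (Matrix.of W), hW⟩, rfl⟩
    · rintro ⟨⟨W', B⟩, ⟨hG', hB⟩, rfl⟩
      have : pinv (Matrix.of W') = Matrix.of B := pinv_eq_of_isMoorePenrose hG'
      simpa [this] using hB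
  rw [key]
  refine (hG.inter (measurable_snd hs)).image_of_measurable_injOn measurable_fst ?_
  rintro ⟨W, B⟩ ⟨hB, -⟩ ⟨W', B'⟩ ⟨hB', -⟩ h
  obtain rfl : W = W' := h
  exact Prod.ext rfl (Matrix.of.injective (hB.unique hB'))

end Pseudoinverse

section Columns

variable {ι κ : Type*}

/-- The matrix with columns `W k`. Columns are vectors of a Euclidean space, so that orthogonal
projections onto spans of columns make sense. -/
def ofColumns (W : κ → EuclideanSpace ℝ ι) : Matrix ι κ ℝ :=
  Matrix.of fun i k => W k i

theorem linearIndependent_col_ofColumns {W : κ → EuclideanSpace ℝ ι}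
    (hW : LinearIndependent ℝ W) : LinearIndependent ℝ (ofColumns W).col :=
  hW.map' (WithLp.linearEquiv 2 ℝ (ι → ℝ)).toLinearMap (LinearEquiv.ker _)

variable [Fintype ι] [Fintype κ]

/-- Row `j` of the pseudoinverse of the matrix with columns `W k`. -/
noncomputable def pinvRow (W : κ → EuclideanSpace ℝ ι) (j : κ) : EuclideanSpace ℝ ι :=
  WithLp.toLp 2 (pinv (ofColumns W) j)

theorem measurable_pinv_ofColumns :
    Measurable fun W : κ → EuclideanSpace ℝ ι => fun k i => pinv (ofColumns W) k i :=
  measurable_pinv.comp (f := fun W : κ → EuclideanSpace ℝ ι => fun i k => W k i) (by fun_prop)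

theorem measurable_pinv_ofColumns_apply (k : κ) (i : ι) :
    Measurable fun W : κ → EuclideanSpace ℝ ι => pinv (ofColumns W) k i :=
  (measurable_pi_apply i).comp ((measurable_pi_apply k).comp measurable_pinv_ofColumns)

theorem measurable_pinvRow (j : κ) :
    Measurable fun W : κ → EuclideanSpace ℝ ι => pinvRow W j :=
  (MeasurableEquiv.toLp 2 (ι → ℝ)).measurable.comp
    ((measurable_pi_apply j).comp measurable_pinv_ofColumns)

theorem inner_pinvRow (W : κ → EuclideanSpace ℝ ι) (j k : κ) :
    inner ℝ (pinvRow W j) (W k) = (pinv (ofColumns W) * ofColumns W) j k := by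
  simp [PiLp.inner_apply, Matrix.mul_apply, pinvRow, ofColumns, mul_comm]

/-- The rows of `A†` are combinations of the columns of `A`, because `A† = (A† A†ᵀ) Aᵀ`. -/
theorem pinvRow_eq_sum (W : κ → EuclideanSpace ℝ ι) (j : κ) :
    pinvRow W j = ∑ k, (pinv (ofColumns W) * (pinv (ofColumns W))ᵀ) j k • W k := by
  have h := pinv_spec (ofColumns W)
  have e : pinv (ofColumns W)
      = pinv (ofColumns W) * (pinv (ofColumns W))ᵀ * (ofColumns W)ᵀ := by
    rw [Matrix.mul_assoc, ← Matrix.transpose_mul, h.symm_left, ← Matrix.mul_assoc, h.mul_self_mul]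
  ext i
  have := congrFun (congrFun e j) i
  simp only [pinvRow]
  rw [this, Matrix.mul_apply]
  simp [ofColumns]

/-- For linearly independent columns, row `j` of the pseudoinverse is `v / ‖v‖²`, where `v` is the
component of the column `W j` orthogonal to the other columns. -/
theorem norm_sq_pinvRow_mul {W : κ → EuclideanSpace ℝ ι} (hW : LinearIndependent ℝ W) (j : κ)
    {V : Submodule ℝ (EuclideanSpace ℝ ι)} (hV : V = Submodule.span ℝ (W '' {j}ᶜ)) :
    ‖pinvRow W j‖ ^ 2 * ‖Vᗮ.orthogonalProjectionOnto (W j)‖ ^ 2 = 1 := by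
  classical
  set c := (pinv (ofColumns W) * (pinv (ofColumns W))ᵀ) j j
  set v := Vᗮ.starProjection (W j) with hv
  have hmem : ∀ k, k ≠ j → W k ∈ V := fun k hk => hV ▸ Submodule.subset_span ⟨k, hk, rfl⟩
  have hdual : ∀ k, inner ℝ (pinvRow W j) (W k) = if j = k then 1 else 0 := fun k => by
    rw [inner_pinvRow, pinv_mul_self_of_linearIndependent (linearIndependent_col_ofColumns hW),
      Matrix.one_apply]
  have hperp : pinvRow W j ∈ Vᗮ := by
    rw [Submodule.mem_orthogonal', hV]
    intro u hu
    induction hu using Submodule.span_induction with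
    | mem x hx =>
      obtain ⟨k, hk, rfl⟩ := hx
      rw [hdual, if_neg (fun h => hk h.symm)]
    | zero => simp
    | add x y _ _ hx hy => rw [inner_add_right, hx, hy, add_zero]
    | smul a x _ hx => rw [inner_smul_right, hx, mul_zero]
  have hrow : pinvRow W j = c • v := by
    rw [← Submodule.starProjection_eq_self_iff.mpr hperp]
    conv_lhs => rw [pinvRow_eq_sum]
    rw [map_sum, Finset.sum_eq_single j]
    · rw [map_smul]
    · intro k _ hk
      rw [map_smul, (Submodule.starProjection_apply_eq_zero_iff _).mpr, smul_zero]
      rw [Submodule.orthogonal_orthogonal]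
      exact hmem k hk
    · simp
  have hone : inner ℝ (pinvRow W j) v = 1 := by
    rw [hv, ← Submodule.inner_starProjection_left_eq_right,
      Submodule.starProjection_eq_self_iff.mpr hperp, hdual, if_pos rfl]
  have hnorm : ‖Vᗮ.orthogonalProjectionOnto (W j)‖ = ‖v‖ := rfl
  rw [hnorm]
  rw [hrow, real_inner_smul_left, real_inner_self_eq_norm_sq] at hone
  rw [hrow, norm_smul, mul_pow, Real.norm_eq_abs, sq_abs, mul_assoc, sq c, mul_assoc]
  rw [← mul_assoc c (‖v‖^2), hone, one_mul, hone]

end Columns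

/-! ### Moments of the standard Gaussian -/

section Gaussian

theorem integral_exp_neg_mul_sq_gaussianReal {t : ℝ} (ht : 0 ≤ t) :
    ∫ x, Real.exp (-(t * x ^ 2)) ∂(gaussianReal 0 1) = (1 + 2 * t) ^ (-(1 / 2) : ℝ) := by
  rw [integral_gaussianReal_eq_integral_smul one_ne_zero]
  have e : ∀ x : ℝ, gaussianPDFReal 0 1 x • Real.exp (-(t * x ^ 2))
      = (√(2 * Real.pi))⁻¹ * Real.exp (-(t + 1 / 2) * x ^ 2) := fun x => by
    rw [gaussianPDFReal, smul_eq_mul, mul_assoc, ← Real.exp_add]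
    simp only [NNReal.coe_one, mul_one]
    congr 2
    ring
  simp_rw [e]
  rw [integral_const_mul, integral_gaussian, Real.rpow_neg (by positivity), ← Real.sqrt_eq_rpow,
    ← Real.sqrt_inv, ← Real.sqrt_inv, ← Real.sqrt_mul (by positivity)]
  congr 1
  field_simp
  ring

theorem lintegral_exp_neg_mul {r : ℝ} (hr : 0 ≤ r) :
    ∫⁻ t in Set.Ioi (0 : ℝ), ENNReal.ofReal (Real.exp (-(t * r))) = (ENNReal.ofReal r)⁻¹ := by
  rcases hr.eq_or_lt with rfl | hr
  · simp
  · have h : ∀ t : ℝ, Real.exp (-(t * r)) = Real.exp (-r * t) := fun t => by ring_nf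
    simp_rw [h]
    rw [← ofReal_integral_eq_lintegral_ofReal
      ((integrableOn_exp_mul_Ioi (neg_neg_iff_pos.mpr hr) 0))
      (ae_of_all _ fun _ => (Real.exp_pos _).le),
      integral_exp_mul_Ioi (neg_neg_iff_pos.mpr hr), ← ENNReal.ofReal_inv_of_pos hr]
    congr 1
    simp

theorem lintegral_one_add_rpow_of_two_lt {m : ℕ} (hm : 2 < m) :
    ∫⁻ t in Set.Ioi (0 : ℝ), ENNReal.ofReal ((1 + 2 * t) ^ (-(m / 2) : ℝ))
      = ENNReal.ofReal (1 / (m - 2)) := by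
  have hm' : (2 : ℝ) < m := by exact_mod_cast hm
  have hd : ∀ t ∈ Set.Ici (0 : ℝ),
      HasDerivAt (fun t : ℝ => -(1 / (m - 2)) * (1 + 2 * t) ^ (1 - m / 2 : ℝ))
        ((1 + 2 * t) ^ (-(m / 2) : ℝ)) t := by
    intro t ht
    have ht : (0 : ℝ) ≤ t := ht
    have h1 : HasDerivAt (fun t : ℝ => 1 + 2 * t) 2 t := by
      simpa using ((hasDerivAt_id t).const_mul 2).const_add 1
    have h2 := (h1.rpow_const (p := 1 - m / 2) (Or.inl (by positivity))).const_mul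
      (-(1 / ((m : ℝ) - 2)))
    convert! h2 using 1
    rw [show (1 : ℝ) - m / 2 - 1 = -(m / 2) by ring]
    have : (m : ℝ) - 2 ≠ 0 := by linarith
    field_simp
    ring
  have hlim : Filter.Tendsto (fun t : ℝ => -(1 / ((m : ℝ) - 2)) * (1 + 2 * t) ^ (1 - m / 2 : ℝ))
      Filter.atTop (nhds 0) := by
    have h1 : Filter.Tendsto (fun t : ℝ => 1 + 2 * t) Filter.atTop Filter.atTop :=
      Filter.tendsto_atTop_add_const_left _ _ (Filter.tendsto_id.const_mul_atTop two_pos)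
    have h2 := ((tendsto_rpow_neg_atTop (y := m / 2 - 1) (by linarith)).comp h1).const_mul
      (-(1 / ((m : ℝ) - 2)))
    rw [mul_zero] at h2
    refine h2.congr fun t => ?_
    simp
  have hpos : ∀ t ∈ Set.Ioi (0 : ℝ), 0 ≤ (1 + 2 * t) ^ (-(m / 2) : ℝ) := fun t ht => by
    have ht : (0 : ℝ) < t := ht
    positivity
  rw [← ofReal_integral_eq_lintegral_ofReal (integrableOn_Ioi_deriv_of_nonneg' hd hpos hlim)
    ((ae_restrict_iff' measurableSet_Ioi).mpr (ae_of_all _ hpos)),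
    integral_Ioi_of_hasDerivAt_of_nonneg' hd hpos hlim]
  simp

theorem lintegral_one_add_rpow_of_le_two {m : ℕ} (hm : m ≤ 2) :
    ∫⁻ t in Set.Ioi (0 : ℝ), ENNReal.ofReal ((1 + 2 * t) ^ (-(m / 2) : ℝ)) = ⊤ := by
  by_contra h
  have hm' : (m : ℝ) ≤ 2 := by exact_mod_cast hm
  refine absurd ((integrableOn_Ioi_rpow_iff (s := -1) one_pos).mp ?_) (lt_irrefl _)
  have h1 : IntegrableOn (fun t : ℝ => (1 + 2 * t) ^ (-(m / 2) : ℝ)) (Set.Ioi 0) := by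
    have hm : Measurable fun t : ℝ => (1 + 2 * t) ^ (-(m / 2) : ℝ) := by fun_prop
    refine ⟨hm.aestronglyMeasurable, ?_⟩
    rw [hasFiniteIntegral_iff_ofReal]
    · exact lt_top_iff_ne_top.mpr h
    · refine (ae_restrict_iff' measurableSet_Ioi).mpr (ae_of_all _ fun t ht => ?_)
      have ht : (0 : ℝ) < t := ht
      simp only [Pi.zero_apply]
      positivity
  -- On `(1, ∞)` the integrand is at least `(1 + 2 t)⁻¹ ≥ t⁻¹ / 3`, which is not integrable.
  have h2 := (h1.mono_set (Set.Ioi_subset_Ioi zero_le_one)).const_mul 3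
  refine Integrable.mono' h2 (by fun_prop) ?_
  refine (ae_restrict_iff' measurableSet_Ioi).mpr (ae_of_all _ fun t ht => ?_)
  have ht : (1 : ℝ) < t := ht
  rw [Real.norm_of_nonneg (by positivity), Real.rpow_neg_one]
  have h3 : (1 + 2 * t)⁻¹ ≤ (1 + 2 * t) ^ (-(m / 2) : ℝ) := by
    rw [← Real.rpow_neg_one]
    exact Real.rpow_le_rpow_of_exponent_le (by linarith) (by linarith)
  have h4 : t⁻¹ ≤ 3 * (1 + 2 * t)⁻¹ := by
    rw [← div_eq_mul_inv, inv_eq_one_div, div_le_div_iff₀ (by positivity) (by positivity)]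
    linarith
  exact h4.trans (by gcongr)

variable {E : Type*} [NormedAddCommGroup E] [InnerProductSpace ℝ E] [FiniteDimensional ℝ E]
  [MeasurableSpace E] [BorelSpace E]

theorem integral_exp_neg_mul_norm_sq_stdGaussian {t : ℝ} (ht : 0 ≤ t) :
    ∫ x, Real.exp (-(t * ‖x‖ ^ 2)) ∂(stdGaussian E)
      = (1 + 2 * t) ^ (-(Module.finrank ℝ E / 2) : ℝ) := by
  let b := stdOrthonormalBasis ℝ E
  have hmeas : Measurable fun x : Fin (Module.finrank ℝ E) → ℝ => ∑ i, x i • b i := by fun_prop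
  rw [stdGaussian_eq_map_pi_orthonormalBasis b, integral_map hmeas.aemeasurable
    (by fun_prop)]
  have e : ∀ x : Fin (Module.finrank ℝ E) → ℝ, Real.exp (-(t * ‖∑ i, x i • b i‖ ^ 2))
      = ∏ i, Real.exp (-(t * x i ^ 2)) := fun x => by
    rw [← Real.exp_sum, ← b.sum_sq_inner_right]
    congr 1
    rw [Finset.sum_neg_distrib, Finset.mul_sum]
    congr 1
    refine Finset.sum_congr rfl fun i _ => ?_
    rw [b.orthonormal.inner_right_fintype]
  simp_rw [e]
  rw [integral_fintype_prod_eq_prod (f := fun _ x => Real.exp (-(t * x ^ 2)))]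
  simp_rw [integral_exp_neg_mul_sq_gaussianReal ht]
  rw [Finset.prod_const, Finset.card_univ, Fintype.card_fin, ← Real.rpow_natCast,
    ← Real.rpow_mul (by positivity)]
  congr 1
  ring

/-- The inverse moment of a chi-squared variable, by writing `1 / r = ∫ exp (-t r) dt` over `t > 0`
and exchanging the two integrals. -/
theorem lintegral_inv_norm_sq_stdGaussian_eq :
    ∫⁻ x, (ENNReal.ofReal (‖x‖ ^ 2))⁻¹ ∂(stdGaussian E)
      = ∫⁻ t in Set.Ioi (0 : ℝ),
          ENNReal.ofReal ((1 + 2 * t) ^ (-(Module.finrank ℝ E / 2) : ℝ)) := by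
  simp_rw [fun x : E => (lintegral_exp_neg_mul (sq_nonneg ‖x‖)).symm]
  rw [lintegral_lintegral_swap (by fun_prop)]
  refine setLIntegral_congr_fun measurableSet_Ioi fun t ht => ?_
  have ht : (0 : ℝ) < t := ht
  rw [← integral_exp_neg_mul_norm_sq_stdGaussian ht.le, ofReal_integral_eq_lintegral_ofReal]
  · refine Integrable.of_bound (by fun_prop) 1 (ae_of_all _ fun x => ?_)
    rw [Real.norm_of_nonneg (Real.exp_pos _).le, Real.exp_le_one_iff]
    have : 0 ≤ t * ‖x‖ ^ 2 := by positivity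
    linarith
  · exact ae_of_all _ fun x => (Real.exp_pos _).le

theorem lintegral_inv_norm_sq_stdGaussian (h : 2 < Module.finrank ℝ E) :
    ∫⁻ x, (ENNReal.ofReal (‖x‖ ^ 2))⁻¹ ∂(stdGaussian E)
      = ENNReal.ofReal (1 / (Module.finrank ℝ E - 2)) := by
  rw [lintegral_inv_norm_sq_stdGaussian_eq, lintegral_one_add_rpow_of_two_lt h]

theorem lintegral_inv_norm_sq_stdGaussian_eq_top (h : Module.finrank ℝ E ≤ 2) :
    ∫⁻ x, (ENNReal.ofReal (‖x‖ ^ 2))⁻¹ ∂(stdGaussian E) = ⊤ := by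
  rw [lintegral_inv_norm_sq_stdGaussian_eq, lintegral_one_add_rpow_of_le_two h]

theorem map_orthogonalProjectionOnto_stdGaussian (V : Submodule ℝ E) :
    (stdGaussian E).map V.orthogonalProjectionOnto = stdGaussian V := by
  apply Measure.ext_of_charFun
  ext t
  rw [charFun_stdGaussian, charFun_apply, integral_map (by fun_prop) (by fun_prop)]
  have e : ∀ x : E, inner ℝ (V.orthogonalProjectionOnto x) t = inner ℝ x (t : E) := fun x =>
    Submodule.inner_orthogonalProjectionOnto_eq_of_mem_right t x
  simp_rw [e]
  rw [← charFun_apply, charFun_stdGaussian, Submodule.coe_norm]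

theorem map_inner_stdGaussian (a : E) :
    (stdGaussian E).map (fun x => inner ℝ x a) = gaussianReal 0 (‖a‖₊ ^ 2) := by
  have h := IsGaussian.map_eq_gaussianReal (μ := stdGaussian E) (innerSL ℝ a)
  rw [integral_strongDual_stdGaussian, variance_dual_stdGaussian, innerSL_apply_norm] at h
  have e : (fun x => inner ℝ x a) = (innerSL ℝ a : E → ℝ) := by
    ext x
    rw [innerSL_apply_apply, real_inner_comm]
  rw [e, h]
  congr 1
  ext
  simp

theorem lintegral_inner_sq_stdGaussian (a : E) :
    ∫⁻ x, ENNReal.ofReal (inner ℝ x a ^ 2) ∂(stdGaussian E) = ENNReal.ofReal (‖a‖ ^ 2) := by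
  have h : MemLp (fun x : E => inner ℝ x a) 2 (stdGaussian E) := by
    have := IsGaussian.memLp_dual (stdGaussian E) (innerSL ℝ a) 2 (by simp)
    refine this.congr_norm (by fun_prop) (ae_of_all _ fun x => ?_)
    rw [innerSL_apply_apply, real_inner_comm]
  have hv := variance_dual_stdGaussian (innerSL ℝ a)
  rw [variance_of_integral_eq_zero (by fun_prop) (integral_strongDual_stdGaussian _),
    innerSL_apply_norm] at hv
  rw [← hv, ← ofReal_integral_eq_lintegral_ofReal h.integrable_sq
    (ae_of_all _ fun x => sq_nonneg _)]
  simp_rw [innerSL_apply_apply, real_inner_comm]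

theorem ae_notMem_stdGaussian {V : Submodule ℝ E} (hV : V ≠ ⊤) :
    ∀ᵐ x ∂(stdGaussian E), x ∉ V := by
  obtain ⟨a, ha, ha0⟩ := V.orthogonal.exists_mem_ne_zero_of_ne_bot
    (fun h => hV (Submodule.orthogonal_eq_bot_iff.mp h))
  have : NullSingletonClass (gaussianReal 0 (‖a‖₊ ^ 2)) :=
    nullSingletonClass_gaussianReal (by simpa using ha0)
  have h0 : ∀ᵐ x ∂(stdGaussian E), inner ℝ x a ≠ 0 := by
    have h1 : ∀ᵐ r ∂(gaussianReal 0 (‖a‖₊ ^ 2)), r ≠ 0 := by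
      rw [ae_iff]
      simp [measure_singleton]
    rw [← map_inner_stdGaussian] at h1
    exact ae_of_ae_map (f := fun x => inner ℝ x a) (by fun_prop) h1
  filter_upwards [h0] with x hx hxV
  exact hx (ha x hxV)

end Gaussian

/-! ### Product measures -/

section ProductMeasures

variable {κ : Type*} [Fintype κ]

/-- Resampling one coordinate of a product of probability measures preserves the product. -/
theorem measurePreserving_update [DecidableEq κ] {α : κ → Type*} [∀ k, MeasurableSpace (α k)]
    (μ : ∀ k, Measure (α k)) [∀ k, IsProbabilityMeasure (μ k)] (j : κ) :
    MeasurePreserving (fun q : (∀ k, α k) × α j => Function.update q.1 j q.2)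
      ((Measure.pi μ).prod (μ j)) (Measure.pi μ) := by
  refine ⟨measurable_update', (Measure.pi_eq fun s hs => ?_).symm⟩
  rw [Measure.map_apply measurable_update' (MeasurableSet.univ_pi hs)]
  have e : (fun q : (∀ k, α k) × α j => Function.update q.1 j q.2) ⁻¹' Set.univ.pi s
      = (Set.univ.pi (Function.update s j Set.univ)) ×ˢ s j := by
    ext ⟨W, w⟩
    simp only [Set.mem_preimage, Set.mem_univ_pi, Set.mem_prod]
    constructor
    · intro h
      refine ⟨fun k => ?_, by simpa using h j⟩
      by_cases hk : k = j
      · subst hk; simp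
      · simpa [hk] using h k
    · rintro ⟨h, hj⟩ k
      by_cases hk : k = j
      · subst hk; simpa using hj
      · simpa [hk] using h k
  rw [e, Measure.prod_prod, Measure.pi_pi, ← Finset.prod_erase_mul _ _ (Finset.mem_univ j),
    ← Finset.prod_erase_mul (a := j) _ _ (Finset.mem_univ j)]
  simp only [Function.update_self, measure_univ, mul_one]
  congr 1
  refine Finset.prod_congr rfl fun k hk => ?_
  rw [Function.update_of_ne (Finset.ne_of_mem_erase hk)]

theorem lintegral_pi_eq_lintegral_update [DecidableEq κ] {α : κ → Type*}
    [∀ k, MeasurableSpace (α k)] (μ : ∀ k, Measure (α k)) [∀ k, IsProbabilityMeasure (μ k)] (j : κ)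
    {F : (∀ k, α k) → ℝ≥0∞} (hF : Measurable F) :
    ∫⁻ W, F W ∂(Measure.pi μ)
      = ∫⁻ W, ∫⁻ w, F (Function.update W j w) ∂(μ j) ∂(Measure.pi μ) := by
  rw [← (measurePreserving_update μ j).lintegral_comp hF, lintegral_prod]
  exact (hF.comp measurable_update').aemeasurable

theorem map_uncurry_pi {ι : Type*} [Fintype ι] (μ : Measure ℝ) [SigmaFinite μ] :
    (Measure.pi fun _ : κ => Measure.pi fun _ : ι => μ).map (fun f (q : κ × ι) => f q.1 q.2)
      = Measure.pi fun _ => μ := by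
  have hm : Measurable fun (f : κ → ι → ℝ) (q : κ × ι) => f q.1 q.2 := by fun_prop
  refine (Measure.pi_eq fun s hs => ?_).symm
  rw [Measure.map_apply hm (MeasurableSet.univ_pi hs)]
  have e : (fun (f : κ → ι → ℝ) (q : κ × ι) => f q.1 q.2) ⁻¹' Set.univ.pi s
      = Set.univ.pi fun k => Set.univ.pi fun i => s (k, i) := by
    ext f
    simp
  rw [e, Measure.pi_pi]
  simp_rw [Measure.pi_pi]
  rw [Fintype.prod_prod_type]

theorem map_swap_pi {ι : Type*} [Fintype ι] (μ : Measure ℝ) [SigmaFinite μ] :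
    (Measure.pi fun _ : κ => Measure.pi fun _ : ι => μ).map (fun f i k => f k i)
      = Measure.pi fun _ : ι => Measure.pi fun _ : κ => μ := by
  have h1 := map_uncurry_pi (κ := κ) (ι := ι) μ
  have h2 := map_uncurry_pi (κ := ι) (ι := κ) μ
  have h3 := (measurePreserving_piCongrLeft (fun _ : ι × κ => μ) (Equiv.prodComm κ ι)).map_eq
  have h4 : (Measure.pi fun _ : κ × ι => μ).map (fun g (q : ι × κ) => g (q.2, q.1))
      = Measure.pi fun _ => μ := by
    rw [← h3]
    congr 1
  let e : (ι → κ → ℝ) ≃ᵐ (ι × κ → ℝ) := (MeasurableEquiv.curry ι κ ℝ).symm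
  refine e.map_measurableEquiv_injective ?_
  have he : (e : (ι → κ → ℝ) → (ι × κ → ℝ)) = fun f q => f q.1 q.2 := rfl
  rw [he, h2, ← h4, ← h1, Measure.map_map (by fun_prop) (by fun_prop),
    Measure.map_map (by fun_prop) (by fun_prop)]
  rfl

end ProductMeasures

/-! ### Gaussian matrices -/

section GaussianMatrices

theorem span_image_ne_top {κ E : Type*} [AddCommGroup E] [Module ℝ E] {W : κ → E}
    {s : Finset κ} (hs : s.card < Module.finrank ℝ E) :
    Submodule.span ℝ (W '' s) ≠ ⊤ := by
  classical
  intro h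
  have h1 := finrank_span_finset_le_card (R := ℝ) (s.image W)
  rw [Set.finrank, Finset.coe_image, h, finrank_top] at h1
  exact absurd (h1.trans Finset.card_image_le) (by omega)

section

variable {κ E : Type*} [Fintype κ] [NormedAddCommGroup E] [InnerProductSpace ℝ E]
  [FiniteDimensional ℝ E] [MeasurableSpace E] [BorelSpace E]

theorem measurableSet_linearIndepOn (s : Finset κ) :
    MeasurableSet {W : κ → E | LinearIndepOn ℝ W (s : Set κ)} := by
  have : Measurable fun (W : κ → E) (k : (s : Set κ)) => W k := by fun_prop
  exact this (isOpen_setOfPred_linearIndependent (𝕜 := ℝ) (E := E) (ι := (s : Set κ))).measurableSet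

/-- At most `dim E` independent standard Gaussian vectors are almost surely linearly independent:
each misses the span of the previous ones. -/
theorem ae_linearIndepOn_stdGaussian (s : Finset κ) (hs : s.card ≤ Module.finrank ℝ E) :
    ∀ᵐ W ∂(Measure.pi fun _ : κ => stdGaussian E), LinearIndepOn ℝ W (s : Set κ) := by
  classical
  induction s using Finset.induction_on with
  | empty => simp
  | insert j s hj ih =>
    rw [Finset.card_insert_of_notMem hj] at hs
    have hmp := measurePreserving_update (fun _ : κ => stdGaussian E) j
    have hset := measurableSet_linearIndepOn (E := E) (insert j s)
    rw [← hmp.map_eq, ae_map_iff hmp.measurable.aemeasurable hset,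
      Measure.ae_prod_iff_ae_ae
        (p := fun q => LinearIndepOn ℝ (Function.update q.1 j q.2) (insert j s : Finset κ))
        (hmp.measurable hset)]
    filter_upwards [ih (by omega)] with W hW
    filter_upwards [ae_notMem_stdGaussian (span_image_ne_top (W := W) (s := s) (by omega))]
      with w hw
    have heq : Set.EqOn (Function.update W j w) W s := fun k hk =>
      Function.update_of_ne (ne_of_mem_of_not_mem (Finset.mem_coe.mp hk) hj) _ _
    simp only [Finset.coe_insert]
    rw [linearIndepOn_insert (by simpa using hj), linearIndepOn_congr heq, heq.image_eq,
      Function.update_self]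
    exact ⟨hW, hw⟩

theorem ae_linearIndependent_stdGaussian (h : Fintype.card κ ≤ Module.finrank ℝ E) :
    ∀ᵐ W ∂(Measure.pi fun _ : κ => stdGaussian E), LinearIndependent ℝ W := by
  filter_upwards [ae_linearIndepOn_stdGaussian (E := E) (Finset.univ : Finset κ) h] with W hW
  rwa [Finset.coe_univ, linearIndepOn_univ_iff] at hW

end

/-- The law of a matrix with independent standard Gaussian entries, as a family of columns. -/
noncomputable def gaussianColumns (ι κ : Type*) [Fintype ι] [Fintype κ] :
    Measure (κ → EuclideanSpace ℝ ι) :=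
  Measure.pi fun _ => stdGaussian (EuclideanSpace ℝ ι)

/-- The expectation of the inverse of a chi-squared variable with `d` degrees of freedom, taken in
`[0, ∞]`. -/
noncomputable def invChiSqMean (d : ℕ) : ℝ≥0∞ :=
  ∫⁻ x, (ENNReal.ofReal (‖x‖ ^ 2))⁻¹ ∂(stdGaussian (EuclideanSpace ℝ (Fin d)))

theorem invChiSqMean_of_two_lt {d : ℕ} (hd : 2 < d) :
    invChiSqMean d = ENNReal.ofReal (1 / (d - 2)) := by
  rw [invChiSqMean, lintegral_inv_norm_sq_stdGaussian (by simpa using hd),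
    finrank_euclideanSpace_fin]

theorem invChiSqMean_of_le_two {d : ℕ} (hd : d ≤ 2) : invChiSqMean d = ⊤ :=
  lintegral_inv_norm_sq_stdGaussian_eq_top (by simpa using hd)

theorem lintegral_inv_norm_sq_eq_invChiSqMean {E : Type*} [NormedAddCommGroup E]
    [InnerProductSpace ℝ E] [FiniteDimensional ℝ E] [MeasurableSpace E] [BorelSpace E] :
    ∫⁻ x, (ENNReal.ofReal (‖x‖ ^ 2))⁻¹ ∂(stdGaussian E) = invChiSqMean (Module.finrank ℝ E) := by
  rw [invChiSqMean, lintegral_inv_norm_sq_stdGaussian_eq, lintegral_inv_norm_sq_stdGaussian_eq,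
    finrank_euclideanSpace_fin]

variable {ι κ : Type*} [Fintype ι] [Fintype κ]

instance : IsProbabilityMeasure (gaussianColumns ι κ) := by
  unfold gaussianColumns; infer_instance

theorem ae_linearIndependent_gaussianColumns (h : Fintype.card κ ≤ Fintype.card ι) :
    ∀ᵐ W ∂(gaussianColumns ι κ), LinearIndependent ℝ W :=
  ae_linearIndependent_stdGaussian (by simpa using h)

/-- Given the other columns, the component of column `j` orthogonal to their span is a standard
Gaussian vector in dimension `card ι - (card κ - 1)`. -/
theorem lintegral_norm_sq_pinvRow (h : Fintype.card κ ≤ Fintype.card ι) (j : κ) :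
    ∫⁻ W, ENNReal.ofReal (‖pinvRow W j‖ ^ 2) ∂(gaussianColumns ι κ)
      = invChiSqMean (Fintype.card ι - Fintype.card κ + 1) := by
  classical
  have hmp := measurePreserving_update (fun _ : κ => stdGaussian (EuclideanSpace ℝ ι)) j
  have hli : ∀ᵐ W ∂(gaussianColumns ι κ), ∀ᵐ w ∂(stdGaussian (EuclideanSpace ℝ ι)),
      LinearIndependent ℝ (Function.update W j w) := by
    have h1 := ae_linearIndependent_gaussianColumns h
    rw [gaussianColumns, ← hmp.map_eq] at h1
    exact Measure.ae_ae_of_ae_prod (ae_of_ae_map hmp.measurable.aemeasurable h1)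
  have hm : Measurable fun W : κ → EuclideanSpace ℝ ι => ENNReal.ofReal (‖pinvRow W j‖ ^ 2) :=
    ((measurable_pinvRow j).norm.pow_const 2).ennreal_ofReal
  rw [gaussianColumns, lintegral_pi_eq_lintegral_update _ j hm]
  have hinner : ∀ᵐ W ∂(gaussianColumns ι κ),
      ∫⁻ w, ENNReal.ofReal (‖pinvRow (Function.update W j w) j‖ ^ 2)
        ∂(stdGaussian (EuclideanSpace ℝ ι))
      = invChiSqMean (Fintype.card ι - Fintype.card κ + 1) := by
    filter_upwards [hli] with W hW
    obtain ⟨w₀, hw₀⟩ := hW.exists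
    set V := Submodule.span ℝ (W '' {j}ᶜ) with hV
    have himage : ∀ w, Function.update W j w '' {j}ᶜ = W '' {j}ᶜ := fun w =>
      Set.EqOn.image_eq fun k hk => Function.update_of_ne hk _ _
    have hdim : Module.finrank ℝ Vᗮ = Fintype.card ι - Fintype.card κ + 1 := by
      have h1 : Module.finrank ℝ V = Fintype.card κ - 1 := by
        have h2 : LinearIndependent ℝ fun k : ({j}ᶜ : Set κ) => Function.update W j w₀ k :=
          hw₀.comp _ Subtype.val_injective
        have h3 := finrank_span_eq_card h2
        rw [show Set.range (fun k : ({j}ᶜ : Set κ) => Function.update W j w₀ k) = W '' {j}ᶜ by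
          rw [← himage w₀, Set.image_eq_range]] at h3
        rw [hV, h3, Fintype.card_compl_set]
        simp
      have h4 := Submodule.finrank_add_finrank_orthogonal V
      rw [finrank_euclideanSpace, h1] at h4
      have h5 : 0 < Fintype.card κ := Fintype.card_pos_iff.mpr ⟨j⟩
      omega
    rw [← hdim, ← lintegral_inv_norm_sq_eq_invChiSqMean,
      ← map_orthogonalProjectionOnto_stdGaussian, lintegral_map (by fun_prop) (by fun_prop)]
    refine lintegral_congr_ae ?_
    filter_upwards [hW] with w hw
    have := norm_sq_pinvRow_mul hw j (V := V) (by rw [himage])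
    rw [Function.update_self] at this
    have hpos : 0 < ‖Vᗮ.orthogonalProjectionOnto w‖ ^ 2 := by
      refine lt_of_le_of_ne (sq_nonneg _) fun h0 => ?_
      rw [← h0, mul_zero] at this
      exact zero_ne_one this
    rw [← ENNReal.ofReal_inv_of_pos hpos, eq_inv_of_mul_eq_one_left this]
  rw [← gaussianColumns, lintegral_congr_ae hinner]
  simp

/-- The squared Frobenius norm. -/
def frobeniusSq (A : Matrix ι κ ℝ) : ℝ :=
  ∑ i, ∑ k, A i k ^ 2

theorem frobeniusSq_transpose (A : Matrix ι κ ℝ) : frobeniusSq Aᵀ = frobeniusSq A :=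
  Finset.sum_comm

theorem measurable_frobeniusSq_pinv_ofColumns :
    Measurable fun W : κ → EuclideanSpace ℝ ι => frobeniusSq (pinv (ofColumns W)) :=
  Finset.measurable_fun_sum _ fun _ _ => Finset.measurable_fun_sum _ fun _ _ =>
    (measurable_pinv_ofColumns_apply _ _).pow_const 2

theorem lintegral_frobeniusSq_pinv_of_le (h : Fintype.card κ ≤ Fintype.card ι) :
    ∫⁻ W, ENNReal.ofReal (frobeniusSq (pinv (ofColumns W))) ∂(gaussianColumns ι κ)
      = Fintype.card κ * invChiSqMean (Fintype.card ι - Fintype.card κ + 1) := by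
  have e : ∀ W : κ → EuclideanSpace ℝ ι, ENNReal.ofReal (frobeniusSq (pinv (ofColumns W)))
      = ∑ j, ENNReal.ofReal (‖pinvRow W j‖ ^ 2) := fun W => by
    rw [← ENNReal.ofReal_sum_of_nonneg fun _ _ => sq_nonneg _]
    simp_rw [EuclideanSpace.real_norm_sq_eq]
    rfl
  simp_rw [e]
  rw [lintegral_finsetSum _ fun j _ => ((measurable_pinvRow j).norm.pow_const 2).ennreal_ofReal]
  simp_rw [lintegral_norm_sq_pinvRow h]
  simp

theorem gaussianColumns_eq_map :
    gaussianColumns ι κ = (Measure.pi fun _ : κ => Measure.pi fun _ : ι => gaussianReal 0 1).map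
      (fun f k => WithLp.toLp 2 (f k)) := by
  have : ∀ _ : κ, SigmaFinite ((Measure.pi fun _ : ι => gaussianReal 0 1).map (WithLp.toLp 2)) :=
    fun _ => by rw [map_pi_eq_stdGaussian]; infer_instance
  rw [Measure.pi_map_pi (fun _ => by fun_prop)]
  simp_rw [map_pi_eq_stdGaussian]
  rfl

/-- Transposing a matrix with independent standard Gaussian entries. -/
theorem measurePreserving_transpose_gaussianColumns :
    MeasurePreserving (fun (W : κ → EuclideanSpace ℝ ι) i => WithLp.toLp 2 fun k => W k i)
      (gaussianColumns ι κ) (gaussianColumns κ ι) := by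
  refine ⟨by fun_prop, ?_⟩
  rw [gaussianColumns_eq_map, gaussianColumns_eq_map, Measure.map_map (by fun_prop) (by fun_prop),
    ← map_swap_pi, Measure.map_map (by fun_prop) (by fun_prop)]
  rfl

theorem lintegral_frobeniusSq_pinv_of_ge (h : Fintype.card ι ≤ Fintype.card κ) :
    ∫⁻ W, ENNReal.ofReal (frobeniusSq (pinv (ofColumns W))) ∂(gaussianColumns ι κ)
      = Fintype.card ι * invChiSqMean (Fintype.card κ - Fintype.card ι + 1) := by
  rw [← lintegral_frobeniusSq_pinv_of_le h,
    ← (measurePreserving_transpose_gaussianColumns (ι := κ) (κ := ι)).lintegral_comp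
      measurable_frobeniusSq_pinv_ofColumns.ennreal_ofReal]
  refine lintegral_congr fun W => ?_
  rw [show ofColumns (fun i => WithLp.toLp 2 fun k => W k i) = (ofColumns W)ᵀ from rfl,
    pinv_transpose, frobeniusSq_transpose]

end GaussianMatrices

/-! ### The projection onto the row space of a Gaussian matrix -/

section RowProjection

variable {ι κ : Type*} [Fintype ι] [Fintype κ]

/-- `A† A`, the orthogonal projection onto the row space of `A`, for `A` with columns `W k`. -/
noncomputable def rowProj (W : κ → EuclideanSpace ℝ ι) : Matrix κ κ ℝ :=
  pinv (ofColumns W) * ofColumns W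

theorem rowProj_transpose (W : κ → EuclideanSpace ℝ ι) : (rowProj W)ᵀ = rowProj W :=
  (pinv_spec _).symm_right

theorem rowProj_mul_self (W : κ → EuclideanSpace ℝ ι) : rowProj W * rowProj W = rowProj W := by
  rw [rowProj, ← Matrix.mul_assoc, (pinv_spec _).mul_self_mul]

theorem rowProj_apply_comm (W : κ → EuclideanSpace ℝ ι) (j k : κ) :
    rowProj W j k = rowProj W k j :=
  congrFun (congrFun (rowProj_transpose W) k) j

theorem abs_rowProj_apply_le_one (W : κ → EuclideanSpace ℝ ι) (j k : κ) :
    |rowProj W j k| ≤ 1 := by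
  have h : ∀ k, rowProj W j k ^ 2 ≤ rowProj W j j := fun k => by
    conv_rhs => rw [← rowProj_mul_self, Matrix.mul_apply]
    simp_rw [rowProj_apply_comm W _ j, ← sq]
    exact Finset.single_le_sum (f := fun k => rowProj W j k ^ 2) (fun _ _ => sq_nonneg _)
      (Finset.mem_univ k)
  rw [← sq_le_one_iff_abs_le_one]
  nlinarith [h j, h k]

theorem measurable_rowProj_apply (j k : κ) :
    Measurable fun W : κ → EuclideanSpace ℝ ι => rowProj W j k := by
  simp only [rowProj, Matrix.mul_apply]
  refine Finset.measurable_fun_sum _ fun i _ => (measurable_pinv_ofColumns_apply j i).mul ?_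
  simp only [ofColumns, Matrix.of_apply]
  fun_prop

theorem integrable_rowProj_apply (j k : κ) :
    Integrable (fun W => rowProj W j k) (gaussianColumns ι κ) :=
  Integrable.of_bound (measurable_rowProj_apply j k).aestronglyMeasurable 1
    (ae_of_all _ fun W => abs_rowProj_apply_le_one W j k)

theorem rowProj_eq_conj [DecidableEq κ] {W W' : κ → EuclideanSpace ℝ ι} {S : Matrix κ κ ℝ}
    (hS : S * Sᵀ = 1) (h : ofColumns W' = ofColumns W * S) :
    rowProj W' = Sᵀ * rowProj W * S := by
  rw [rowProj, h, pinv_mul_of_orthogonal _ hS, rowProj]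
  simp only [Matrix.mul_assoc]

theorem measurePreserving_neg_stdGaussian :
    MeasurePreserving (fun x : EuclideanSpace ℝ ι => -x) (stdGaussian (EuclideanSpace ℝ ι))
      (stdGaussian (EuclideanSpace ℝ ι)) :=
  ⟨measurable_neg, stdGaussian_map (LinearIsometryEquiv.neg ℝ)⟩

/-- Flipping the sign of column `j` preserves the law and negates the entry `(j, k)`. -/
theorem integral_rowProj_apply_of_ne {j k : κ} (hjk : j ≠ k) :
    ∫ W, rowProj W j k ∂(gaussianColumns ι κ) = 0 := by
  classical
  let f : κ → EuclideanSpace ℝ ι → EuclideanSpace ℝ ι := fun l x => if l = j then -x else x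
  have hf : ∀ l, MeasurePreserving (f l) (stdGaussian (EuclideanSpace ℝ ι))
      (stdGaussian (EuclideanSpace ℝ ι)) := fun l => by
    by_cases h : l = j
    · simpa [f, h] using measurePreserving_neg_stdGaussian
    · simp only [f, h, if_false]
      exact MeasurePreserving.id _
  have hmp := measurePreserving_pi _ _ hf
  have hS : Matrix.diagonal (fun l => if l = j then (-1 : ℝ) else 1)
      * (Matrix.diagonal fun l => if l = j then (-1 : ℝ) else 1)ᵀ = 1 := by
    rw [Matrix.diagonal_transpose, Matrix.diagonal_mul_diagonal, ← Matrix.diagonal_one]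
    congr 1
    ext l
    split_ifs <;> norm_num
  have hflip : ∀ W : κ → EuclideanSpace ℝ ι, rowProj (fun l => f l (W l)) j k = -rowProj W j k := by
    intro W
    rw [rowProj_eq_conj (W := W) hS]
    · simp [Matrix.mul_diagonal, Matrix.diagonal_mul, Matrix.diagonal_transpose, hjk.symm]
    · ext i l
      rw [Matrix.mul_diagonal]
      by_cases h : l = j <;> simp [ofColumns, f, h]
  have h := integral_map (μ := gaussianColumns ι κ) hmp.measurable.aemeasurable
    (measurable_rowProj_apply (ι := ι) j k).aestronglyMeasurable
  rw [gaussianColumns, hmp.map_eq] at h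
  simp_rw [hflip, integral_neg] at h
  rw [gaussianColumns]
  linarith

/-- Exchanging two columns preserves the law. -/
theorem integral_rowProj_apply_self_eq (j k : κ) :
    ∫ W, rowProj W j j ∂(gaussianColumns ι κ) = ∫ W, rowProj W k k ∂(gaussianColumns ι κ) := by
  classical
  let σ := Equiv.swap j k
  have hmp := measurePreserving_piCongrLeft
    (fun _ : κ => stdGaussian (EuclideanSpace ℝ ι)) σ
  have hS : ((1 : Matrix κ κ ℝ).submatrix id σ) * ((1 : Matrix κ κ ℝ).submatrix id σ)ᵀ = 1 := by
    rw [Matrix.transpose_submatrix, Matrix.transpose_one, Matrix.submatrix_mul_equiv]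
    simp
  have hswap : ∀ W : κ → EuclideanSpace ℝ ι,
      rowProj (MeasurableEquiv.piCongrLeft (fun _ : κ => EuclideanSpace ℝ ι) σ W) j j
        = rowProj W k k := by
    intro W
    have hσ : ∀ l,
        MeasurableEquiv.piCongrLeft (fun _ : κ => EuclideanSpace ℝ ι) σ W l = W (σ l) := by
      intro l
      have := MeasurableEquiv.piCongrLeft_apply_apply (β := fun _ : κ => EuclideanSpace ℝ ι)
        σ W (σ l)
      rwa [Equiv.swap_apply_self] at this
    rw [rowProj_eq_conj (W := W) hS]
    · rw [Matrix.transpose_submatrix, Matrix.transpose_one]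
      simp [Matrix.mul_apply, Matrix.one_apply, σ]
    · ext i l
      simp [Matrix.mul_apply, Matrix.one_apply, ofColumns, hσ]
  have h := integral_map (μ := gaussianColumns ι κ) hmp.measurable.aemeasurable
    (measurable_rowProj_apply (ι := ι) j j).aestronglyMeasurable
  rw [gaussianColumns, hmp.map_eq] at h
  simp_rw [hswap] at h
  exact h

theorem ae_rowProj_eq_one [DecidableEq κ] (h : Fintype.card κ ≤ Fintype.card ι) :
    ∀ᵐ W ∂(gaussianColumns ι κ), rowProj W = 1 := by
  filter_upwards [ae_linearIndependent_gaussianColumns h] with W hW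
  exact pinv_mul_self_of_linearIndependent (linearIndependent_col_ofColumns hW)

theorem ae_trace_rowProj (h : Fintype.card ι ≤ Fintype.card κ) :
    ∀ᵐ W ∂(gaussianColumns ι κ), (rowProj W).trace = Fintype.card ι := by
  classical
  have hmp := measurePreserving_transpose_gaussianColumns (ι := ι) (κ := κ)
  have h1 := ae_rowProj_eq_one (ι := κ) (κ := ι) h
  rw [← hmp.map_eq] at h1
  filter_upwards [ae_of_ae_map hmp.measurable.aemeasurable h1] with W hW
  rw [rowProj, show ofColumns (fun i => WithLp.toLp 2 fun k => W k i) = (ofColumns W)ᵀ from rfl,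
    pinv_transpose, ← Matrix.transpose_mul, Matrix.transpose_eq_one] at hW
  rw [rowProj, Matrix.trace_mul_comm, hW, Matrix.trace_one]

theorem integral_rowProj_apply_self (h : Fintype.card ι ≤ Fintype.card κ) (j : κ) :
    ∫ W, rowProj W j j ∂(gaussianColumns ι κ) = Fintype.card ι / Fintype.card κ := by
  have hκ : (Fintype.card κ : ℝ) ≠ 0 :=
    Nat.cast_ne_zero.mpr (Fintype.card_pos_iff.mpr ⟨j⟩).ne'
  have h1 : ∫ W, (rowProj W).trace ∂(gaussianColumns ι κ) = Fintype.card ι := by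
    rw [integral_congr_ae (ae_trace_rowProj h)]
    simp
  simp only [Matrix.trace, Matrix.diag_apply] at h1
  rw [integral_finsetSum _ fun k _ => integrable_rowProj_apply k k] at h1
  simp_rw [fun k => integral_rowProj_apply_self_eq (ι := ι) k j] at h1
  rw [Finset.sum_const, Finset.card_univ, nsmul_eq_mul] at h1
  rw [eq_div_iff hκ, mul_comm, h1]

theorem norm_sq_sub_rowProj_mulVec (W : κ → EuclideanSpace ℝ ι) (u : κ → ℝ) :
    ∑ j, (u j - (rowProj W *ᵥ u) j) ^ 2 = ∑ j, u j ^ 2 - ∑ j, ∑ k, u j * u k * rowProj W j k := by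
  have h1 : ∑ j, ∑ k, u j * u k * rowProj W j k = u ⬝ᵥ (rowProj W *ᵥ u) := by
    simp only [dotProduct, Matrix.mulVec, Finset.mul_sum]
    exact Finset.sum_congr rfl fun j _ => Finset.sum_congr rfl fun k _ => by ring
  have h2 : (rowProj W *ᵥ u) ⬝ᵥ (rowProj W *ᵥ u) = u ⬝ᵥ (rowProj W *ᵥ u) := by
    rw [Matrix.dotProduct_mulVec, ← Matrix.mulVec_transpose, rowProj_transpose,
      Matrix.mulVec_mulVec, rowProj_mul_self, dotProduct_comm]
  have h3 : ∑ j, (u j - (rowProj W *ᵥ u) j) ^ 2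
      = (u - rowProj W *ᵥ u) ⬝ᵥ (u - rowProj W *ᵥ u) := by
    simp [dotProduct, sq]
  have h4 : ∑ j, u j ^ 2 = u ⬝ᵥ u := by simp [dotProduct, sq]
  rw [h1, h3, h4, sub_dotProduct, dotProduct_sub, dotProduct_sub, h2,
    dotProduct_comm (rowProj W *ᵥ u) u]
  ring

/-- The mean squared distance from `u` to the row space: the expected projection is
`(card ι / card κ) • 1` if there are at least as many columns as rows, and `1` otherwise. -/
theorem lintegral_norm_sq_sub_rowProj_mulVec (u : κ → ℝ) :
    ∫⁻ W, ENNReal.ofReal (∑ j, (u j - (rowProj W *ᵥ u) j) ^ 2) ∂(gaussianColumns ι κ)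
      = ENNReal.ofReal ((∑ j, u j ^ 2) * max (1 - (Fintype.card ι : ℝ) / Fintype.card κ) 0) := by
  classical
  rcases le_total (Fintype.card κ) (Fintype.card ι) with h | h
  · have h1 : (∑ j, u j ^ 2) * max (1 - (Fintype.card ι : ℝ) / Fintype.card κ) 0 = 0 := by
      rcases isEmpty_or_nonempty κ with hκ | hκ
      · simp
      · have hκ : (0 : ℝ) < Fintype.card κ := Nat.cast_pos.mpr Fintype.card_pos
        have : (1 : ℝ) ≤ Fintype.card ι / Fintype.card κ :=
          (one_le_div hκ).mpr (Nat.cast_le.mpr h)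
        rw [max_eq_right (by linarith), mul_zero]
    rw [h1, lintegral_congr_ae (g := fun _ => 0)]
    · simp
    · filter_upwards [ae_rowProj_eq_one h] with W hW
      simp [hW]
  · simp_rw [norm_sq_sub_rowProj_mulVec]
    have hint : ∀ j k, Integrable (fun W => u j * u k * rowProj W j k) (gaussianColumns ι κ) :=
      fun j k => (integrable_rowProj_apply j k).const_mul _
    have hint' : ∀ j, Integrable (fun W => ∑ k, u j * u k * rowProj W j k) (gaussianColumns ι κ) :=
      fun j => integrable_finsetSum _ fun k _ => hint j k
    have hsum : Integrable (fun W => ∑ j, ∑ k, u j * u k * rowProj W j k) (gaussianColumns ι κ) :=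
      integrable_finsetSum _ fun j _ => hint' j
    rw [← ofReal_integral_eq_lintegral_ofReal (f := fun W => ∑ j, u j ^ 2 -
      ∑ j, ∑ k, u j * u k * rowProj W j k) ((integrable_const _).sub hsum)]
    · congr 1
      rw [integral_sub (integrable_const _) hsum, integral_finsetSum _ fun j _ => hint' j]
      simp_rw [fun j => integral_finsetSum Finset.univ fun k _ => hint j k, integral_const_mul]
      have h1 : ∀ j, ∑ k, u j * u k * ∫ W, rowProj W j k ∂(gaussianColumns ι κ)
          = u j ^ 2 * (Fintype.card ι / Fintype.card κ) := fun j => by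
        rw [Finset.sum_eq_single j, integral_rowProj_apply_self h, sq]
        · intro k _ hk
          rw [integral_rowProj_apply_of_ne hk.symm, mul_zero]
        · simp
      have h2 : (Fintype.card ι : ℝ) / Fintype.card κ ≤ 1 :=
        div_le_one_of_le₀ (Nat.cast_le.mpr h) (Nat.cast_nonneg _)
      simp_rw [h1]
      rw [← Finset.sum_mul, max_eq_left (by linarith), integral_const]
      simp
      ring
    · refine ae_of_all _ fun W => ?_
      simp only [Pi.zero_apply]
      rw [← norm_sq_sub_rowProj_mulVec]
      exact Finset.sum_nonneg fun _ _ => sq_nonneg _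

end RowProjection

/-! ### The risk -/

section Risk

/-- A fixed linear combination of independent standard Gaussian vectors has the second moments of
a scaled standard Gaussian vector. -/
theorem lintegral_inner_sum_sq {J E : Type*} [Fintype J] [NormedAddCommGroup E]
    [InnerProductSpace ℝ E] [FiniteDimensional ℝ E] [MeasurableSpace E] [BorelSpace E]
    (c : J → ℝ) (r : E) :
    ∫⁻ Z, ENNReal.ofReal (inner ℝ r (∑ j, c j • Z j) ^ 2) ∂(Measure.pi fun _ : J => stdGaussian E)
      = ENNReal.ofReal ((∑ j, c j ^ 2) * ‖r‖ ^ 2) := by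
  let μ : Measure (J → E) := Measure.pi fun _ : J => stdGaussian E
  let L : E → ℝ := innerSL ℝ r
  have hL : MemLp L 2 (stdGaussian E) :=
    IsGaussian.memLp_dual (stdGaussian E) (innerSL ℝ r) 2 (by simp)
  have hX : ∀ j, MemLp (fun x => c j * L x) 2 (stdGaussian E) := fun j => hL.const_mul _
  have hcomp : ∀ j, MemLp (fun Z : J → E => c j * L (Z j)) 2 μ := fun j =>
    (hX j).comp_measurePreserving (measurePreserving_eval (fun _ : J => stdGaussian E) j)
  have hsum : MemLp (∑ j, fun Z : J → E => c j * L (Z j)) 2 μ :=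
    memLp_finsetSum' _ fun j _ => hcomp j
  have e : ∀ Z : J → E, inner ℝ r (∑ j, c j • Z j) = (∑ j, fun Z : J → E => c j * L (Z j)) Z := by
    intro Z
    rw [inner_sum, Finset.sum_apply]
    simp [L, inner_smul_right]
  have hmean : ∫ Z, (∑ j, fun Z : J → E => c j * L (Z j)) Z ∂μ = 0 := by
    simp_rw [Finset.sum_apply]
    rw [integral_finsetSum _ fun j _ => (hcomp j).integrable one_le_two]
    refine Finset.sum_eq_zero fun j _ => ?_
    rw [integral_const_mul, integral_comp_eval (μ := fun _ : J => stdGaussian E) (f := L)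
      hL.aestronglyMeasurable, integral_strongDual_stdGaussian, mul_zero]
  have hvar : Var[∑ j, fun Z : J → E => c j * L (Z j); μ] = (∑ j, c j ^ 2) * ‖r‖ ^ 2 := by
    rw [variance_sum_pi (μ := fun _ : J => stdGaussian E) (X := fun j x => c j * L x) hX,
      Finset.sum_mul]
    refine Finset.sum_congr rfl fun j _ => ?_
    rw [variance_const_mul, variance_dual_stdGaussian, innerSL_apply_norm]
  simp_rw [e]
  rw [← hvar, variance_of_integral_eq_zero hsum.aestronglyMeasurable.aemeasurable hmean,
    ofReal_integral_eq_lintegral_ofReal hsum.integrable_sq (ae_of_all _ fun Z => sq_nonneg _)]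

theorem lintegral_prod_const_add_add {α γ : Type*} [MeasurableSpace α] [MeasurableSpace γ]
    (μ : Measure α) (ν : Measure γ) [IsProbabilityMeasure μ] [IsProbabilityMeasure ν] (c : ℝ≥0∞)
    {f : α → ℝ≥0∞} {g : α × γ → ℝ≥0∞} (hf : Measurable f) (hg : Measurable g) :
    ∫⁻ q, c + f q.1 + g q ∂(μ.prod ν) = c + ∫⁻ a, f a ∂μ + ∫⁻ a, ∫⁻ b, g (a, b) ∂ν ∂μ := by
  have hf' : Measurable fun q : α × γ => f q.1 := hf.comp measurable_fst
  rw [lintegral_add_right _ hg, lintegral_add_right _ hf', lintegral_prod _ hg.aemeasurable,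
    lintegral_prod _ hf'.aemeasurable]
  simp

variable {n D : ℕ}

theorem norm_sq_subvec (A : Finset (Fin D)) (v : EuclideanSpace ℝ (Fin D)) :
    ‖subvec A v‖ ^ 2 = ∑ j ∈ A, v j ^ 2 := by
  rw [EuclideanSpace.real_norm_sq_eq, ← Finset.sum_coe_sort A]
  rfl

theorem measurable_betaHat_inner (T : Finset (Fin D)) (β : EuclideanSpace ℝ (Fin D)) :
    Measurable fun xs : Fin n → EuclideanSpace ℝ (Fin D) =>
      betaHat T xs fun i => inner ℝ (xs i) β := by
  have hp : Measurable fun xs : Fin n → EuclideanSpace ℝ (Fin D) =>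
      fun k i => pinv (design T xs) k i :=
    measurable_pinv.comp (f := fun (xs : Fin n → EuclideanSpace ℝ (Fin D)) i (j : T) => xs i j)
      (by fun_prop)
  refine (MeasurableEquiv.toLp 2 (Fin D → ℝ)).measurable.comp (measurable_pi_lambda _ fun j => ?_)
  by_cases h : j ∈ T
  · simp only [h, dite_true, Matrix.mulVec, dotProduct]
    refine Finset.measurable_fun_sum _ fun i _ => ?_
    exact ((measurable_pi_apply i).comp ((measurable_pi_apply _).comp hp)).mul (by fun_prop)
  · simp [h]

/-- The estimation error splits orthogonally into the coefficients outside `T`, the distance from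
`β_T` to the row space of `X_T`, and the image under `X_T†` of the contribution of the columns
outside `T` to the response. -/
theorem norm_sq_sub_betaHat (T : Finset (Fin D)) (β : EuclideanSpace ℝ (Fin D))
    (C : Fin D → EuclideanSpace ℝ (Fin n)) :
    ‖β - betaHat T (fun i => WithLp.toLp 2 fun j => C j i)
        (fun i => inner ℝ (WithLp.toLp 2 fun j => C j i) β)‖ ^ 2
      = ‖subvec Tᶜ β‖ ^ 2
        + ∑ k : T, (β k - (rowProj (fun k : T => C k) *ᵥ fun k : T => β k) k) ^ 2
        + ∑ k, inner ℝ (pinvRow (fun k : T => C k) k)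
            (∑ j : {j // j ∉ T}, β j • C j) ^ 2 := by
  classical
  set W : T → EuclideanSpace ℝ (Fin n) := fun k => C k with hW
  set u : T → ℝ := fun k => β k with hu
  set z : EuclideanSpace ℝ (Fin n) := ∑ j : {j // j ∉ T}, β j • C j with hz
  set B := pinv (ofColumns W) with hB
  set ys : Fin n → ℝ := fun i => inner ℝ (WithLp.toLp 2 fun j => C j i) β with hys
  have hy : ys = ofColumns W *ᵥ u + z.ofLp := by
    ext i
    have h1 : ys i = ∑ j, β j * C j i := by
      simp [hys, PiLp.inner_apply]
    have h2 : z i = ∑ j : {j // j ∉ T}, β j * C j i := by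
      simp [hz]
    have h3 : (ofColumns W *ᵥ u) i = ∑ j : T, β j * C j i := by
      simp only [Matrix.mulVec, dotProduct, ofColumns, Matrix.of_apply]
      exact Finset.sum_congr rfl fun j _ => mul_comm _ _
    rw [Pi.add_apply, h1, h2, h3]
    convert (Fintype.sum_subtype_add_sum_subtype (fun j => j ∈ T) fun j => β j * C j i).symm
  have hBz : ∀ k, (B *ᵥ z.ofLp) k = inner ℝ (pinvRow W k) z := by
    intro k
    simp [Matrix.mulVec, dotProduct, PiLp.inner_apply, pinvRow, hB, mul_comm]
  have hfit : B *ᵥ ys = rowProj W *ᵥ u + B *ᵥ z.ofLp := by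
    rw [hy, Matrix.mulVec_add, Matrix.mulVec_mulVec, rowProj]
  have horth : (u - rowProj W *ᵥ u) ⬝ᵥ (B *ᵥ z.ofLp) = 0 := by
    have h1 : rowProj W *ᵥ (B *ᵥ z.ofLp) = B *ᵥ z.ofLp := by
      rw [Matrix.mulVec_mulVec, rowProj, (pinv_spec _).mul_self_mul]
    have h2 : (rowProj W *ᵥ u) ⬝ᵥ (B *ᵥ z.ofLp) = u ⬝ᵥ (B *ᵥ z.ofLp) := by
      rw [dotProduct_comm, Matrix.dotProduct_mulVec, ← Matrix.mulVec_transpose,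
        rowProj_transpose, h1, dotProduct_comm]
    rw [sub_dotProduct, h2, sub_self]
  have hsplit : ∑ k, (u k - (B *ᵥ ys) k) ^ 2
      = ∑ k, (u k - (rowProj W *ᵥ u) k) ^ 2 + ∑ k, inner ℝ (pinvRow W k) z ^ 2 := by
    have h1 : ∑ k, (u k - (rowProj W *ᵥ u) k) * (B *ᵥ z.ofLp) k = 0 := horth
    simp_rw [hfit, ← hBz]
    rw [← sub_eq_zero, ← Finset.sum_add_distrib, ← Finset.sum_sub_distrib]
    rw [← mul_zero (-2 : ℝ), ← h1, Finset.mul_sum]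
    refine Finset.sum_congr rfl fun k _ => ?_
    rw [Pi.add_apply]
    ring
  rw [add_assoc, ← hsplit, EuclideanSpace.real_norm_sq_eq, norm_sq_subvec,
    ← Finset.sum_compl_add_sum T]
  congr 1
  · refine Finset.sum_congr rfl fun j hj => ?_
    simp [betaHat, Finset.mem_compl.mp hj]
  · rw [← Finset.sum_coe_sort T]
    refine Finset.sum_congr rfl fun k _ => ?_
    simp [betaHat, hB, hu]
    rfl

/-- Integrating the decomposition of the estimation error: the columns outside `T` are independent
of those in `T`, and enter only through a Gaussian vector of variance `‖β_{Tᶜ}‖²`. -/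
theorem lintegral_norm_sq_sub_betaHat (T : Finset (Fin D)) (β : EuclideanSpace ℝ (Fin D)) :
    ∫⁻ xs, ENNReal.ofReal (‖β - betaHat T xs fun i => inner ℝ (xs i) β‖ ^ 2)
        ∂(gaussianColumns (Fin D) (Fin n))
      = ENNReal.ofReal (‖subvec Tᶜ β‖ ^ 2)
        + ENNReal.ofReal (‖subvec T β‖ ^ 2 * max (1 - (n : ℝ) / T.card) 0)
        + ENNReal.ofReal (‖subvec Tᶜ β‖ ^ 2)
          * ∫⁻ W, ENNReal.ofReal (frobeniusSq (pinv (ofColumns W)))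
              ∂(gaussianColumns (Fin n) T) := by
  classical
  have hmeas : Measurable fun xs : Fin n → EuclideanSpace ℝ (Fin D) =>
      ENNReal.ofReal (‖β - betaHat T xs fun i => inner ℝ (xs i) β‖ ^ 2) :=
    ((measurable_const.sub (measurable_betaHat_inner T β)).norm.pow_const 2).ennreal_ofReal
  rw [← (measurePreserving_transpose_gaussianColumns (ι := Fin n) (κ := Fin D)).lintegral_comp
    hmeas]
  simp_rw [norm_sq_sub_betaHat T β]
  let Z := {j // j ∉ T} → EuclideanSpace ℝ (Fin n)
  let f : (T → EuclideanSpace ℝ (Fin n)) → ℝ := fun W =>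
    ∑ k : T, (β k - (rowProj W *ᵥ fun k : T => β k) k) ^ 2
  let g : (T → EuclideanSpace ℝ (Fin n)) × Z → ℝ := fun q =>
    ∑ k, inner ℝ (pinvRow q.1 k) (∑ j : {j // j ∉ T}, β j • q.2 j) ^ 2
  have hf : Measurable f := by
    refine Finset.measurable_fun_sum _ fun k _ => (measurable_const.sub ?_).pow_const 2
    exact Finset.measurable_fun_sum _ fun l _ => (measurable_rowProj_apply k l).mul_const _
  have hg1 : ∀ k, Measurable fun q : (T → EuclideanSpace ℝ (Fin n)) × Z =>
      inner ℝ (pinvRow q.1 k) (∑ j : {j // j ∉ T}, β j • q.2 j) ^ 2 := fun k =>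
    (((measurable_pinvRow k).comp measurable_fst).inner (by fun_prop)).pow_const 2
  have hg : Measurable g := Finset.measurable_fun_sum _ fun k _ => hg1 k
  have hf0 : ∀ W, 0 ≤ f W := fun W => Finset.sum_nonneg fun _ _ => sq_nonneg _
  have hg0 : ∀ q, 0 ≤ g q := fun q => Finset.sum_nonneg fun _ _ => sq_nonneg _
  have hmp : MeasurePreserving
      (MeasurableEquiv.piEquivPiSubtypeProd (fun _ : Fin D => EuclideanSpace ℝ (Fin n)) (· ∈ T))
      (gaussianColumns (Fin n) (Fin D))
      ((gaussianColumns (Fin n) T).prod (gaussianColumns (Fin n) {j // j ∉ T})) := by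
    unfold gaussianColumns
    convert measurePreserving_piEquivPiSubtypeProd
      (fun _ : Fin D => stdGaussian (EuclideanSpace ℝ (Fin n))) (· ∈ T)
  have hsplit := hmp.lintegral_comp (f := fun q => ENNReal.ofReal (‖subvec Tᶜ β‖ ^ 2)
    + ENNReal.ofReal (f q.1) + ENNReal.ofReal (g q))
    ((measurable_const.add (hf.comp measurable_fst).ennreal_ofReal).add hg.ennreal_ofReal)
  have hlhs : ∀ C : Fin D → EuclideanSpace ℝ (Fin n),
      ENNReal.ofReal (‖subvec Tᶜ β‖ ^ 2
        + ∑ k : T, (β k - (rowProj (fun k : T => C k) *ᵥ fun k : T => β k) k) ^ 2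
        + ∑ k, inner ℝ (pinvRow (fun k : T => C k) k)
            (∑ j : {j // j ∉ T}, β j • C j) ^ 2)
      = ENNReal.ofReal (‖subvec Tᶜ β‖ ^ 2)
        + ENNReal.ofReal (f fun k : T => C k)
        + ENNReal.ofReal (g (fun k : T => C k, fun j => C j)) := fun C => by
    rw [ENNReal.ofReal_add (add_nonneg (sq_nonneg _) (hf0 fun k : T => C k))
      (hg0 (fun k : T => C k, fun j => C j)), ENNReal.ofReal_add (sq_nonneg _) (hf0 _)]
  simp_rw [hlhs]
  refine hsplit.trans ?_
  rw [lintegral_prod_const_add_add _ _ _ hf.ennreal_ofReal hg.ennreal_ofReal]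
  congr 1
  · congr 1
    have h1 := lintegral_norm_sq_sub_rowProj_mulVec (ι := Fin n) (κ := T) fun k : T => β k
    refine h1.trans ?_
    rw [norm_sq_subvec, ← Finset.sum_coe_sort T, Fintype.card_fin, Fintype.card_coe]
  · rw [← lintegral_const_mul _ measurable_frobeniusSq_pinv_ofColumns.ennreal_ofReal]
    refine lintegral_congr fun W => ?_
    simp_rw [g, fun Z : Z => ENNReal.ofReal_sum_of_nonneg (s := Finset.univ)
      (f := fun k => inner ℝ (pinvRow W k) (∑ j : {j // j ∉ T}, β j • Z j) ^ 2)
      fun _ _ => sq_nonneg _]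
    have hgW : ∀ k, Measurable fun Z : Z =>
        ENNReal.ofReal (inner ℝ (pinvRow W k) (∑ j : {j // j ∉ T}, β j • Z j) ^ 2) := fun k =>
      ((hg1 k).comp (measurable_prodMk_left (x := W))).ennreal_ofReal
    rw [lintegral_finsetSum _ fun k _ => hgW k]
    refine (Finset.sum_congr rfl fun k _ =>
      lintegral_inner_sum_sq (fun j : {j // j ∉ T} => β j) (pinvRow W k)).trans ?_
    have h1 : ∑ j : {j // j ∉ T}, β j ^ 2 = ‖subvec Tᶜ β‖ ^ 2 := by
      rw [norm_sq_subvec]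
      exact (Finset.sum_subtype Tᶜ (fun j => Finset.mem_compl) fun j => β j ^ 2).symm
    rw [h1, ← ENNReal.ofReal_sum_of_nonneg fun _ _ => by positivity, ← Finset.mul_sum,
      ENNReal.ofReal_mul (sq_nonneg _)]
    simp_rw [EuclideanSpace.real_norm_sq_eq]
    rfl

/-- The risk is the expected squared estimation error: given the sample, `x` is standard normal, so
the mean squared prediction error of `b` is `‖β - b‖²`. -/
theorem risk_betaHat_eq {Ω : Type*} [MeasurableSpace Ω] (P : Measure Ω) [IsProbabilityMeasure P]
    (β : EuclideanSpace ℝ (Fin D)) (x : Ω → EuclideanSpace ℝ (Fin D)) (y : Ω → ℝ)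
    (X : Fin n → Ω → EuclideanSpace ℝ (Fin D)) (Y : Fin n → Ω → ℝ)
    (hx : HasLaw x (stdGaussian (EuclideanSpace ℝ (Fin D))) P)
    (hy : ∀ᵐ ω ∂P, y ω = inner ℝ (x ω) β)
    (hident : ∀ i, IdentDistrib (fun ω => (X i ω, Y i ω)) (fun ω => (x ω, y ω)) P P)
    (hindep : iIndepFun (fun i ω => (X i ω, Y i ω)) P)
    (hnew : IndepFun (fun ω => (x ω, y ω)) (fun ω i => (X i ω, Y i ω)) P)
    (T : Finset (Fin D)) :
    risk P x y (fun ω => betaHat T (fun i => X i ω) fun i => Y i ω)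
      = ∫⁻ xs, ENNReal.ofReal (‖β - betaHat T xs fun i => inner ℝ (xs i) β‖ ^ 2)
          ∂(gaussianColumns (Fin D) (Fin n)) := by
  have hY : ∀ᵐ ω ∂P, ∀ i, Y i ω = inner ℝ (X i ω) β := by
    rw [ae_all_iff]
    intro i
    refine (hident i).symm.ae_snd (p := fun q => q.2 = inner ℝ q.1 β) ?_ hy
    exact measurableSet_eq_fun measurable_snd (measurable_fst.inner measurable_const)
  have hXm : ∀ i, AEMeasurable (X i) P := fun i =>
    measurable_fst.comp_aemeasurable (hident i).aemeasurable_fst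
  have hXlaw : ∀ i, P.map (X i) = stdGaussian (EuclideanSpace ℝ (Fin D)) := fun i => by
    have := (hident i).comp measurable_fst
    exact this.map_eq.trans hx.map_eq
  have hXs : P.map (fun ω i => X i ω) = gaussianColumns (Fin D) (Fin n) := by
    have h1 : iIndepFun X P := hindep.comp (fun _ => Prod.fst) fun _ => measurable_fst
    rw [(iIndepFun_iff_map_fun_eq_pi_map hXm).mp h1]
    simp_rw [hXlaw]
    rfl
  have hjoint : P.map (fun ω => (x ω, fun i => X i ω))
      = (stdGaussian (EuclideanSpace ℝ (Fin D))).prod (gaussianColumns (Fin D) (Fin n)) := by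
    have h1 : IndepFun x (fun ω i => X i ω) P :=
      hnew.comp (φ := Prod.fst) 
        (ψ := fun (q : Fin n → EuclideanSpace ℝ (Fin D) × ℝ) i => (q i).1)
        measurable_fst (by fun_prop)
    rw [(indepFun_iff_map_prod_eq_prod_map_map hx.aemeasurable
      (aemeasurable_pi_lambda _ hXm)).mp h1, hx.map_eq, hXs]
  have hb := measurable_betaHat_inner (n := n) T β
  have hm : Measurable fun q : EuclideanSpace ℝ (Fin D) × (Fin n → EuclideanSpace ℝ (Fin D)) =>
      ENNReal.ofReal (inner ℝ q.1 (β - betaHat T q.2 fun i => inner ℝ (q.2 i) β) ^ 2) :=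
    ((measurable_fst.inner (measurable_const.sub (hb.comp measurable_snd))).pow_const
      2).ennreal_ofReal
  have h1 : risk P x y (fun ω => betaHat T (fun i => X i ω) fun i => Y i ω)
      = ∫⁻ ω, ENNReal.ofReal (inner ℝ (x ω)
          (β - betaHat T (fun i => X i ω) fun i => inner ℝ (X i ω) β) ^ 2) ∂P := by
    refine lintegral_congr_ae ?_
    filter_upwards [hy, hY] with ω h2 h3
    simp_rw [h3]
    rw [h2, inner_sub_right]
  rw [h1, ← lintegral_map' hm.aemeasurable (hx.aemeasurable.prodMk (aemeasurable_pi_lambda _ hXm)),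
    hjoint, lintegral_prod_symm' _ hm]
  refine lintegral_congr fun xs => ?_
  exact lintegral_inner_sq_stdGaussian (β - betaHat T xs fun i => inner ℝ (xs i) β)

end Risk

end LeastNorm

theorem theorem1 {Ω : Type*} [MeasurableSpace Ω] (P : Measure Ω) [IsProbabilityMeasure P]
    (n D p : ℕ) (β : EuclideanSpace ℝ (Fin D))
    (x : Ω → EuclideanSpace ℝ (Fin D)) (y : Ω → ℝ)
    (X : Fin n → Ω → EuclideanSpace ℝ (Fin D)) (Y : Fin n → Ω → ℝ)
    -- `x` is standard normal and `y = xᵀ β`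
    (hx : HasLaw x (stdGaussian (EuclideanSpace ℝ (Fin D))) P)
    (hy : ∀ᵐ ω ∂P, y ω = inner ℝ (x ω) β)
    -- the sample consists of `n` iid copies of `(x, y)`, independent of `(x, y)`
    (hident : ∀ i, IdentDistrib (fun ω => (X i ω, Y i ω)) (fun ω => (x ω, y ω)) P P)
    (hindep : iIndepFun (fun i ω => (X i ω, Y i ω)) P)
    (hnew : IndepFun (fun ω => (x ω, y ω)) (fun ω i => (X i ω, Y i ω)) P)
    (T : Finset (Fin D)) (hT : T.card = p) :
    let R : ℝ≥0∞ :=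
      LeastNorm.risk P x y fun ω => LeastNorm.betaHat T (fun i => X i ω) (fun i => Y i ω)
    (p + 2 ≤ n →
      R = ENNReal.ofReal
        (‖LeastNorm.subvec Tᶜ β‖ ^ 2 * (1 + (p : ℝ) / ((n : ℝ) - p - 1)))) ∧
    (1 ≤ n → 1 ≤ p → n ≤ p + 1 → p ≤ n + 1 → LeastNorm.subvec Tᶜ β ≠ 0 → R = ⊤) ∧
    (n + 2 ≤ p →
      R = ENNReal.ofReal
        (‖LeastNorm.subvec T β‖ ^ 2 * (1 - (n : ℝ) / p) +
          ‖LeastNorm.subvec Tᶜ β‖ ^ 2 * (1 + (n : ℝ) / ((p : ℝ) - n - 1)))) ∧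
    (LeastNorm.subvec Tᶜ β = 0 →
      R = ENNReal.ofReal (‖LeastNorm.subvec T β‖ ^ 2 * max (1 - (n : ℝ) / p) 0)) := by
  intro R
  have hR : R = _ := (LeastNorm.risk_betaHat_eq P β x y X Y hx hy hident hindep hnew T).trans
    (LeastNorm.lintegral_norm_sq_sub_betaHat T β)
  rw [hT] at hR
  have hσ : 0 ≤ ‖LeastNorm.subvec Tᶜ β‖ ^ 2 := sq_nonneg _
  have htall : p ≤ n → ∫⁻ W, ENNReal.ofReal
      (LeastNorm.frobeniusSq (LeastNorm.pinv (LeastNorm.ofColumns W)))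
        ∂(LeastNorm.gaussianColumns (Fin n) T) = p * LeastNorm.invChiSqMean (n - p + 1) := by
    intro h
    rw [LeastNorm.lintegral_frobeniusSq_pinv_of_le (by simpa [hT] using h)]
    simp [hT]
  have hwide : n ≤ p → ∫⁻ W, ENNReal.ofReal
      (LeastNorm.frobeniusSq (LeastNorm.pinv (LeastNorm.ofColumns W)))
        ∂(LeastNorm.gaussianColumns (Fin n) T) = n * LeastNorm.invChiSqMean (p - n + 1) := by
    intro h
    rw [LeastNorm.lintegral_frobeniusSq_pinv_of_ge (by simpa [hT] using h)]
    simp [hT]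
  refine ⟨fun h => ?_, fun hn hp h1 h2 h0 => ?_, fun h => ?_, fun h0 => ?_⟩
  · -- With `p ≤ n` the first summand vanishes; for `p = 0` this is because `β_T` is empty.
    have hJ : ‖LeastNorm.subvec T β‖ ^ 2 * max (1 - (n : ℝ) / p) 0 = 0 := by
      rcases Nat.eq_zero_or_pos p with rfl | hp
      · rw [LeastNorm.norm_sq_subvec, Finset.card_eq_zero.mp hT]
        simp
      · have : (1 : ℝ) ≤ n / p := (one_le_div (Nat.cast_pos.mpr hp)).mpr
          (Nat.cast_le.mpr (by omega))
        rw [max_eq_right (by linarith), mul_zero]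
    have hd : ((n - p + 1 : ℕ) : ℝ) - 2 = n - p - 1 := by
      rw [Nat.cast_add, Nat.cast_sub (by omega)]
      push_cast
      ring
    have hpos : (0 : ℝ) < n - p - 1 := by
      have : ((p + 2 : ℕ) : ℝ) ≤ n := Nat.cast_le.mpr h
      push_cast at this
      linarith
    rw [hR, hJ, htall (by omega), LeastNorm.invChiSqMean_of_two_lt (by omega), hd,
      ENNReal.ofReal_zero, add_zero, ← ENNReal.ofReal_natCast p,
      ← ENNReal.ofReal_mul (Nat.cast_nonneg _), ← ENNReal.ofReal_mul hσ,
      ← ENNReal.ofReal_add hσ (by positivity)]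
    congr 1
    ring
  · have hσ' : ENNReal.ofReal (‖LeastNorm.subvec Tᶜ β‖ ^ 2) ≠ 0 := by
      rw [ne_eq, ENNReal.ofReal_eq_zero, not_le]
      have := norm_pos_iff.mpr h0
      positivity
    have hQ : ∫⁻ W, ENNReal.ofReal
        (LeastNorm.frobeniusSq (LeastNorm.pinv (LeastNorm.ofColumns W)))
          ∂(LeastNorm.gaussianColumns (Fin n) T) = ⊤ := by
      rcases le_total p n with h | h
      · rw [htall h, LeastNorm.invChiSqMean_of_le_two (by omega), ENNReal.mul_top]
        exact Nat.cast_ne_zero.mpr (by omega)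
      · rw [hwide h, LeastNorm.invChiSqMean_of_le_two (by omega), ENNReal.mul_top]
        exact Nat.cast_ne_zero.mpr (by omega)
    rw [hR, hQ, ENNReal.mul_top hσ', add_top]
  · have hd : ((p - n + 1 : ℕ) : ℝ) - 2 = p - n - 1 := by
      rw [Nat.cast_add, Nat.cast_sub (by omega)]
      push_cast
      ring
    have hnp : ((n + 2 : ℕ) : ℝ) ≤ p := Nat.cast_le.mpr h
    push_cast at hnp
    have hpos : (0 : ℝ) < p - n - 1 := by linarith
    have hle : (n : ℝ) / p ≤ 1 := div_le_one_of_le₀ (by linarith) (Nat.cast_nonneg _)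
    have hJ : 0 ≤ ‖LeastNorm.subvec T β‖ ^ 2 * (1 - (n : ℝ) / p) :=
      mul_nonneg (sq_nonneg _) (by linarith)
    rw [hR, hwide (by omega), LeastNorm.invChiSqMean_of_two_lt (by omega), hd,
      max_eq_left (by linarith), ← ENNReal.ofReal_natCast n,
      ← ENNReal.ofReal_mul (Nat.cast_nonneg _), ← ENNReal.ofReal_mul hσ,
      ← ENNReal.ofReal_add hσ hJ, ← ENNReal.ofReal_add (by positivity) (by positivity)]
    congr 1
    ring
  · rw [hR, h0]
    simp
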